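/- **Proposition 2.5.** Notation. Let $d\ge 1$ be an integer. For $\alpha\in\mathbf N^d$ let $|\alpha|=\alpha_1+\cdots+\alpha_d$, $\alpha!=\alpha_1!\cdots\alpha_d!$, and let $h_\alpha(x)=\pi^{-d/4}(-1)^{|\alpha|}(2^{|\alpha|}\alpha!)^{-1/2}e^{|x|^2/2}\,\partial^\alpha e^{-|x|^2}$, $x\in\mathbf R^d$, be the Hermite functions. The index set $\overline{\mathbf R_\flat}$ consists of the real numbers $s\ge 0$ and of symbols $\flat_\sigma$, one for each real $\sigma>0$; it is ordered by the usual order on the real numbers, by $\flat_\sigma<\flat_\tau$ if $\sigma<\tau$, and by $x<\flat_\sigma<y$ whenever $0\le x<\frac12\le y$. For $r>0$ and $0\ne s\in\overline{\mathbf R_\flat}$ let $\vartheta_{r,s}(\alpha)=e^{r|\alpha|^{1/(2s)}}$ if $s$ is real and $\vartheta_{r,s}(\alpha)=r^{|\alpha|}(\alpha!)^{1/(2\sigma)}$ if $s=\flat_\sigma$. Fix $p\in[1,\infty]$ (the spaces below do not depend on it). For $s\neq 0$, let $\mathcal H_s(\mathbf R^d)$ (resp. $\mathcal H_{0,s}(\mathbf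 R^d)$) be the set of all Hermite series $f=\sum_{\alpha\in\mathbf N^d}c(f,\alpha)h_\alpha$ such that $\{c(f,\alpha)\vartheta_{r,s}(\alpha)\}_{\alpha}\in\ell^p(\mathbf N^d)$ for some $r>0$ (resp. for every $r>0$), and let $\mathcal H_0(\mathbf R^d)$ be the set of all finite linear combinations of Hermite functions. For $t\in\mathbf R^d$, the fractional Fourier transform of order $t$ is given by $\mathscr F_tf=\sum_{\alpha}e^{-i\frac\pi2\langle t,\alpha\rangle}c(f,\alpha)h_\alpha$. Finally, with $\langle x\rangle=(1+|x|^2)^{1/2}$, let $$\omega_{d,r,s}(x)=\begin{cases}e^{-r(\log\langle x\rangle)^{1/(1-2s)}},& s\in\mathbf R,\ 0\le s<\tfrac12,\\ e^{-r|x|^{2\sigma/(\sigma+1)}},& s=\flat_\sigma,\\ e^{-r|x|^2},& s=\tfrac12.\end{cases}$$ Statement. Let $s\in\overline{\mathbf R_\flat}$ with $s<\frac12$ and $f\in\mathcal H_s(\mathbf R^d)$ (resp. $0<s\le\frac12$ and $f\in\mathcal H_{0,s}(\mathbf R^d)$). Then, for every $t\in\mathbf R^d$, the series defining $\mathscr F_tf$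 converges unconditionally and uniformly on $\mathbf R^d$, so that $\mathscr F_tf$ is a function, and $$\sup_{t\in\mathbf R^d}\big\|\mathscr F_tf\cdot e^{\frac12|\cdot|^2}\,\omega_{d,r,s}\big\|_{L^\infty(\mathbf R^d)}<\infty$$ for some $r>0$ (resp. for every $r>0$). -/

import Mathlib

open MeasureTheory Filter
open scoped ENNReal Nat

noncomputable section

namespace Pilipovic

/-- The extended index set `ℝ_♭ ∪ {0}`: the non-negative real numbers together with the symbols
`♭_σ`, `σ > 0`. -/
inductive Index : Type
  | real (s : ℝ) (hs : 0 ≤ s) : Index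
  | flat (σ : ℝ) (hσ : 0 < σ) : Index

namespace Index

/-- The strict order on indices: the usual order on real numbers, `♭_σ < ♭_τ` iff `σ < τ`, and
`x < ♭_σ < y` whenever `x < 1/2 ≤ y`. -/
protected def Lt : Index → Index → Prop
  | real s _, real t _ => s < t
  | real s _, flat _ _ => s < 1 / 2
  | flat _ _, real t _ => 1 / 2 ≤ t
  | flat σ _, flat τ _ => σ < τ

instance : LT Index := ⟨Index.Lt⟩

instance : LE Index := ⟨fun a b => a < b ∨ a = b⟩

/-- The index `0`. -/
def zero : Index := real 0 le_rfl

/-- The index `1/2`. -/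
def half : Index := real (1 / 2) (by norm_num)

end Index

/-- Families `{c(α)}` of complex numbers indexed by multi-indices `α ∈ ℕ^d`. -/
abbrev Seq (d : ℕ) : Type := (Fin d → ℕ) → ℂ

/-- The length `|α| = α_1 + ⋯ + α_d` of a multi-index. -/
def length {d : ℕ} (α : Fin d → ℕ) : ℕ := ∑ j, α j

/-- The factorial `α! = α_1! ⋯ α_d!` of a multi-index. -/
def multiFactorial {d : ℕ} (α : Fin d → ℕ) : ℕ := ∏ j, (α j)!

/-- The weights `ϑ_{r,s}` on `ℕ^d`: `exp (r |α|^{1/(2s)})` for real `s > 0`, and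
`r^{|α|} (α!)^{1/(2σ)}` for `s = ♭_σ`. (The value at `s = 0` is never used.) -/
def seqWeight {d : ℕ} (r : ℝ) : Index → (Fin d → ℕ) → ℝ
  | .real s _, α => Real.exp (r * (length α : ℝ) ^ (1 / (2 * s)))
  | .flat σ _, α => r ^ length α * (multiFactorial α : ℝ) ^ (1 / (2 * σ))

/-- The weighted space `ℓ^p_{[ϑ]}(ℕ^d)`. -/
def weightedEll (d : ℕ) (p : ℝ≥0∞) (θ : (Fin d → ℕ) → ℝ) : Set (Seq d) :=
  {c | Memℓp (fun α => c α * (θ α : ℂ)) p}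

open Classical in
/-- The space `ℓ_s(ℕ^d)`: the finitely supported families if `s = 0`, and the union over `r > 0`
of the spaces `ℓ^p_{[ϑ_{r,s}]}(ℕ^d)` otherwise. -/
def ellRoumieu (d : ℕ) (p : ℝ≥0∞) (s : Index) : Set (Seq d) :=
  if s = Index.zero then {c | (Function.support c).Finite}
  else ⋃ (r : ℝ) (_ : 0 < r), weightedEll d p (seqWeight r s)

open Classical in
/-- The space `ℓ_{0,s}(ℕ^d)`: the zero space if `s = 0`, and the intersection over `r > 0`
of the spaces `ℓ^p_{[ϑ_{r,s}]}(ℕ^d)` otherwise. -/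
def ellBeurling (d : ℕ) (p : ℝ≥0∞) (s : Index) : Set (Seq d) :=
  if s = Index.zero then {0}
  else ⋂ (r : ℝ) (_ : 0 < r), weightedEll d p (seqWeight r s)

/-- The space `𝓗_0'(ℝ^d)` of formal Hermite series expansions `∑_α c(α) h_α`. -/
@[ext]
structure FormalHermiteSeries (d : ℕ) : Type where
  /-- The Hermite coefficients `c(f, α)`. -/
  coeff : Seq d

/-- The map `T_𝓗` sending `{c(α)}` to the formal series `∑_α c(α) h_α`. -/
def toSeries {d : ℕ} (c : Seq d) : FormalHermiteSeries d := ⟨c⟩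

/-- The Pilipović space of Roumieu type `𝓗_s(ℝ^d)`. -/
def spaceRoumieu (d : ℕ) (p : ℝ≥0∞) (s : Index) : Set (FormalHermiteSeries d) :=
  toSeries '' ellRoumieu d p s

/-- The Pilipović space of Beurling type `𝓗_{0,s}(ℝ^d)`. -/
def spaceBeurling (d : ℕ) (p : ℝ≥0∞) (s : Index) : Set (FormalHermiteSeries d) :=
  toSeries '' ellBeurling d p s

/-- The Hermite function on the line,
`h_n(x) = π^{-1/4} (-1)^n (2^n n!)^{-1/2} e^{x^2/2} (d/dx)^n e^{-x^2}`. -/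
def hermiteFun (n : ℕ) (x : ℝ) : ℝ :=
  Real.pi ^ (-(1 / 4) : ℝ) * (-1) ^ n * ((2 : ℝ) ^ n * (n ! : ℝ)) ^ (-(1 / 2) : ℝ)
    * Real.exp (x ^ 2 / 2) * iteratedDeriv n (fun y : ℝ => Real.exp (-y ^ 2)) x

/-- The Hermite function `h_α` on `ℝ^d`. As `e^{-|x|^2}` is the product of the `e^{-x_j^2}`, the
formula `π^{-d/4} (-1)^{|α|} (2^{|α|} α!)^{-1/2} e^{|x|^2/2} ∂^α e^{-|x|^2}` is the product of the
one-dimensional Hermite functions. -/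
def hermiteFunMulti {d : ℕ} (α : Fin d → ℕ) (x : EuclideanSpace ℝ (Fin d)) : ℝ :=
  ∏ j, hermiteFun (α j) (x j)

/-- The formal series `u` is the function `g`: the series `∑_α c(u, α) h_α` converges
(unconditionally) to `g`, uniformly on `ℝ^d`. Such a `g` is unique and continuous, and it is also
the sum of the series in the sense of tempered distributions. -/
def FormalHermiteSeries.IsFunction {d : ℕ} (u : FormalHermiteSeries d)
    (g : EuclideanSpace ℝ (Fin d) → ℂ) : Prop :=
  TendstoUniformly
    (fun (S : Finset (Fin d → ℕ)) (x : EuclideanSpace ℝ (Fin d)) =>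
      ∑ α ∈ S, u.coeff α * (hermiteFunMulti α x : ℂ)) g atTop

/-- The fractional Fourier transform `𝓕_t` of (multiple) order `t ∈ ℝ^d` on formal Hermite series,
`𝓕_t h_α = e^{-i ⟨t, α⟩ π / 2} h_α`. For `t = (1, …, 1)` it is the Fourier transform, since
`ℱ h_α = (-i)^{|α|} h_α`. Equivalently, the Bargmann transform, which sends `h_α` to
`z^α / √α!`, turns `𝓕_t` into the substitution `z_j ↦ e^{-i t_j π / 2} z_j`. -/
def fracFourier {d : ℕ} (t : EuclideanSpace ℝ (Fin d)) (u : FormalHermiteSeries d) :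
    FormalHermiteSeries d :=
  ⟨fun α => Complex.exp (-Complex.I * ((∑ j, t j * (α j : ℝ) : ℝ) : ℂ) * (Real.pi / 2 : ℝ))
    * u.coeff α⟩

/-- The weights `ω_{d,r,s}`, depending only on `|z|`, with `⟨z⟩ = (1 + |z|^2)^{1/2}`:
`exp (-r (log ⟨z⟩)^{1/(1-2s)})` for real `s < 1/2`, `exp (-r |z|^{2σ/(σ+1)})` for `s = ♭_σ`, and
`exp (-r |z|^2)` for `s = 1/2`. (The value for real `s > 1/2` is never used.) -/
def omega {E : Type*} [Norm E] (r : ℝ) : Index → E → ℝ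
  | .real s _, z =>
    if s < 1 / 2 then Real.exp (-r * (Real.log (Real.sqrt (1 + ‖z‖ ^ 2))) ^ (1 / (1 - 2 * s)))
    else Real.exp (-r * ‖z‖ ^ 2)
  | .flat σ _, z => Real.exp (-r * ‖z‖ ^ (2 * σ / (σ + 1)))

/-- The supremum over `t ∈ ℝ^d` of the `L^∞` norm of `g_t · e^{|·|^2/2} · ω_{d,r,s}`. -/
def supWeightedNorm {d : ℕ} (r : ℝ) (s : Index)
    (g : EuclideanSpace ℝ (Fin d) → EuclideanSpace ℝ (Fin d) → ℂ) : ℝ≥0∞ :=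
  ⨆ t : EuclideanSpace ℝ (Fin d),
    eLpNorm (fun x => g t x * ((Real.exp (‖x‖ ^ 2 / 2) * omega r s x : ℝ) : ℂ)) ∞ volume

end Pilipovic

end

/-! The operator `fracFourier t` multiplies each coefficient by a unimodular number, so any estimate
using only |c(α)| is uniform in t. It suffices to bound |c(α)| |h_α(x)| e^{|x|²/2} ω(x) by K
2^{-|α|}, which is summable over ℕ^d.

On the line, h_n(x) e^{x²/2} is, up to π^{-1/4}, H_n(x)/√(2^n n!), and the three-term recurrence
bounds it by 2^n Σ_{k≤n} (√2|x|)^k/√k! (`abs_hermitePhys_div_le`). This is used in two ways.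

For s = ♭_σ or s = 1/2 the coefficients decay like R^{|α|} (α!)^{-a}, with a = 1/(2σ) or a = 0.
Since (k+m)! ≥ k! m!, the two factorial powers combine into k!^{-(a+1/2)}, and u^k k!^{-b} ≤ exp(b
u^{1/b}) produces the growth exponent 1/(a+1/2), which is 2σ/(σ+1) or 2
(`exists_pow_mul_abs_hermiteFun_le`).

For real s < 1/2 the cruder bound (6⟨x⟩)^{|α|} is enough: when s > 0, Young's inequality with
conjugate exponents 1/(2s) and 1/(1-2s) balances |α| log⟨x⟩ against the decay exp(-r|α|^{1/(2s)});
when s = 0 the degree is bounded. -/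

namespace Pilipovic

/-- The (physicists') Hermite polynomials as functions, given by their three-term recurrence. -/
def hermitePhys : ℕ → ℝ → ℝ
  | 0, _ => 1
  | 1, x => 2 * x
  | n + 2, x => 2 * x * hermitePhys (n + 1) x - 2 * (n + 1) * hermitePhys n x

/-! ### Hermite functions on the line: formula and pointwise bounds -/

lemma hasDerivAt_hermitePhys_succ (n : ℕ) (x : ℝ) :
    HasDerivAt (hermitePhys (n + 1)) (2 * (n + 1) * hermitePhys n x) x := by
  induction n using Nat.strong_induction_on with
  | _ n ih =>
    match n with
    | 0 =>
      have hf : hermitePhys (0 + 1) = fun y => 2 * y := by funext y; simp [hermitePhys]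
      rw [hf]
      exact ((hasDerivAt_id' x).const_mul (2 : ℝ)).congr_deriv (by simp [hermitePhys])
    -- H_2 is treated apart: its recurrence involves the constant H_0, which is not of the form
    -- H_{n+1} and so escapes the induction hypothesis.
    | 1 =>
      have hf : hermitePhys (1 + 1) = fun y => 2 * y * hermitePhys (0 + 1) y - 2 := by
        funext y; simp [hermitePhys]
      rw [hf]
      refine ((((hasDerivAt_id' x).const_mul (2 : ℝ)).fun_mul (ih 0 one_pos)).sub_const
        2).congr_deriv ?_
      simp [hermitePhys]
      ring
    | n + 2 =>
      have hf : hermitePhys (n + 2 + 1) = fun y => 2 * y * hermitePhys (n + 1 + 1) y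
          - 2 * ((n + 1 : ℕ) + 1) * hermitePhys (n + 1) y := by
        funext y; simp [hermitePhys]
      rw [hf]
      refine ((((hasDerivAt_id' x).const_mul (2 : ℝ)).fun_mul (ih (n + 1) (by omega))).fun_sub
        ((ih n (by omega)).const_mul (2 * ((n + 1 : ℕ) + 1) : ℝ))).congr_deriv ?_
      simp only [hermitePhys]
      push_cast
      ring

lemma hasDerivAt_hermitePhys_mul_gaussian (n : ℕ) (x : ℝ) :
    HasDerivAt (fun y => hermitePhys n y * Real.exp (-y ^ 2))
      (-(hermitePhys (n + 1) x * Real.exp (-x ^ 2))) x := by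
  have he : HasDerivAt (fun y : ℝ => Real.exp (-y ^ 2)) (Real.exp (-x ^ 2) * (-(2 * x))) x :=
    ((hasDerivAt_pow 2 x).fun_neg).exp.congr_deriv (by simp)
  cases n with
  | zero =>
    have hf : hermitePhys 0 = fun _ => 1 := by funext y; simp [hermitePhys]
    rw [hf]
    refine ((hasDerivAt_const x (1 : ℝ)).fun_mul he).congr_deriv ?_
    simp [hermitePhys]
    ring
  | succ n =>
    refine ((hasDerivAt_hermitePhys_succ n x).fun_mul he).congr_deriv ?_
    simp only [hermitePhys]
    ring

lemma iteratedDeriv_gaussian (n : ℕ) :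
    iteratedDeriv n (fun y : ℝ => Real.exp (-y ^ 2))
      = fun x => (-1) ^ n * (hermitePhys n x * Real.exp (-x ^ 2)) := by
  induction n with
  | zero => funext x; simp [hermitePhys]
  | succ n ih =>
    funext x
    rw [iteratedDeriv_succ, ih,
      ((hasDerivAt_hermitePhys_mul_gaussian n x).const_mul ((-1 : ℝ) ^ n)).deriv]
    ring

lemma hermiteFun_mul_exp (n : ℕ) (x : ℝ) :
    hermiteFun n x * Real.exp (x ^ 2 / 2)
      = Real.pi ^ (-(1 / 4) : ℝ) * (hermitePhys n x / √((2 : ℝ) ^ n * (n ! : ℝ))) := by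
  have h1 : ((2 : ℝ) ^ n * (n ! : ℝ)) ^ (-(1 / 2) : ℝ) = (√((2 : ℝ) ^ n * (n ! : ℝ)))⁻¹ := by
    rw [Real.rpow_neg (by positivity), Real.sqrt_eq_rpow]
  have h2 : Real.exp (x ^ 2 / 2) * Real.exp (-x ^ 2) * Real.exp (x ^ 2 / 2) = 1 := by
    rw [← Real.exp_add, ← Real.exp_add, Real.exp_eq_one_iff]
    ring
  have h3 : ((-1 : ℝ) ^ n) * (-1) ^ n = 1 := by
    rw [← mul_pow]; simp
  rw [hermiteFun, iteratedDeriv_gaussian, h1]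
  calc _ = Real.pi ^ (-(1 / 4) : ℝ) * (hermitePhys n x / √((2 : ℝ) ^ n * (n ! : ℝ)))
        * (((-1 : ℝ) ^ n) * (-1) ^ n)
        * (Real.exp (x ^ 2 / 2) * Real.exp (-x ^ 2) * Real.exp (x ^ 2 / 2)) := by
          rw [div_eq_mul_inv]; ring
    _ = _ := by rw [h2, h3]; ring

/-- After normalisation the recurrence reads q_{n+2} ≤ y/√(n+2) · q_{n+1} + q_n. Multiplication by
y/√(n+2) shifts the terms y^k/√k! up by one index, and 2^{n+1} + 2^n ≤ 2^{n+2} closes the induction.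
-/
lemma abs_hermitePhys_div_le (n : ℕ) (x : ℝ) :
    |hermitePhys n x| / √((2 : ℝ) ^ n * (n ! : ℝ))
      ≤ 2 ^ n * ∑ k ∈ Finset.range (n + 1), (√2 * |x|) ^ k / √(k ! : ℝ) := by
  set y := √2 * |x| with hy
  have hy0 : 0 ≤ y := by positivity
  induction n using Nat.strong_induction_on with
  | _ n ih =>
    match n with
    | 0 => simp [hermitePhys]
    | 1 =>
      simp only [hermitePhys, Finset.sum_range_succ, Finset.sum_range_zero]
      have : |2 * x| / √2 = y := by
        rw [abs_mul, hy]
        rw [div_eq_iff (by positivity), mul_right_comm, Real.mul_self_sqrt (by norm_num)]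
        simp
      simp only [pow_one, Nat.factorial_one, Nat.cast_one, mul_one, this, Nat.factorial_zero]
      simp
      linarith
    | n + 2 =>
      have i1 := ih (n + 1) (by omega)
      have i0 := ih n (by omega)
      set S : ℕ → ℝ := fun m => ∑ k ∈ Finset.range (m + 1), y ^ k / √(k ! : ℝ) with hS
      have hs1 : √((2 : ℝ) ^ (n + 2) * ((n + 2) ! : ℝ))
          = √2 * √((n : ℝ) + 2) * √((2 : ℝ) ^ (n + 1) * ((n + 1) ! : ℝ)) := by
        rw [← Real.sqrt_mul (by positivity), ← Real.sqrt_mul (by positivity)]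
        congr 1
        rw [Nat.factorial_succ (n + 1)]
        push_cast
        ring
      have hs0 : √((2 : ℝ) ^ (n + 1) * ((n + 1) ! : ℝ))
          = √2 * √((n : ℝ) + 1) * √((2 : ℝ) ^ n * (n ! : ℝ)) := by
        rw [← Real.sqrt_mul (by positivity), ← Real.sqrt_mul (by positivity)]
        congr 1
        rw [Nat.factorial_succ n]
        push_cast
        ring
      set q1 := |hermitePhys (n + 1) x| / √((2 : ℝ) ^ (n + 1) * ((n + 1) ! : ℝ)) with hq1
      set q0 := |hermitePhys n x| / √((2 : ℝ) ^ n * (n ! : ℝ)) with hq0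
      have e1 : |hermitePhys (n + 1) x| = q1 * √((2 : ℝ) ^ (n + 1) * ((n + 1) ! : ℝ)) := by
        rw [hq1]; field_simp
      have e0 : |hermitePhys n x| = q0 * √((2 : ℝ) ^ n * (n ! : ℝ)) := by
        rw [hq0]; field_simp
      have q00 : 0 ≤ q0 := by positivity
      have h2 : √2 * √2 = (2 : ℝ) := Real.mul_self_sqrt (by norm_num)
      have step : |hermitePhys (n + 2) x| / √((2 : ℝ) ^ (n + 2) * ((n + 2) ! : ℝ))
          ≤ y / √((n : ℝ) + 2) * q1 + q0 := by
        rw [div_le_iff₀ (by positivity)]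
        calc |hermitePhys (n + 2) x|
            ≤ |2 * x * hermitePhys (n + 1) x| + |2 * (n + 1) * hermitePhys n x| := by
              simp only [hermitePhys]
              exact abs_sub _ _
          _ = 2 * |x| * |hermitePhys (n + 1) x| + 2 * (n + 1) * |hermitePhys n x| := by
              rw [abs_mul, abs_mul, abs_mul, abs_of_nonneg (by positivity : (0 : ℝ) ≤ 2 * (n + 1))]
              simp
          _ ≤ y / √((n : ℝ) + 2) * q1 * √((2 : ℝ) ^ (n + 2) * ((n + 2) ! : ℝ))
              + q0 * √((2 : ℝ) ^ (n + 2) * ((n + 2) ! : ℝ)) := by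
              gcongr ?_ + ?_
              · rw [e1, hs1, hy]
                apply le_of_eq
                field_simp
                linear_combination (-1 : ℝ) * h2 * |x| * q1
              · rw [e0, hs1, hs0]
                have hn : ((n : ℝ) + 1) ≤ √((n : ℝ) + 2) * √((n : ℝ) + 1) := by
                  rw [← Real.sqrt_mul (by positivity)]
                  apply Real.le_sqrt_of_sq_le
                  nlinarith
                calc 2 * ((n : ℝ) + 1) * (q0 * √((2 : ℝ) ^ n * (n ! : ℝ)))
                    ≤ 2 * (√((n : ℝ) + 2) * √((n : ℝ) + 1)) * (q0 * √((2 : ℝ) ^ n * (n ! : ℝ))) := by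
                      gcongr
                  _ = _ := by
                      linear_combination (-1 : ℝ) * h2 * (√((n : ℝ) + 2) * √((n : ℝ) + 1))
                        * (q0 * √((2 : ℝ) ^ n * (n ! : ℝ)))
          _ = _ := by ring
      have hmono : S n ≤ S (n + 2) :=
        Finset.sum_le_sum_of_subset_of_nonneg (by simp) (fun _ _ _ => by positivity)
      have hshift : y / √((n : ℝ) + 2) * S (n + 1) ≤ S (n + 2) := by
        simp only [hS]
        rw [Finset.mul_sum, Finset.sum_range_succ' _ (n + 2)]
        have : ∀ k ∈ Finset.range (n + 2),
            y / √((n : ℝ) + 2) * (y ^ k / √(k ! : ℝ)) ≤ y ^ (k + 1) / √((k + 1) ! : ℝ) := by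
          intro k hk
          have hk' : (k : ℝ) + 1 ≤ n + 2 := by
            have := Finset.mem_range.mp hk
            exact_mod_cast (by omega : k + 1 ≤ n + 2)
          rw [div_mul_div_comm, ← Real.sqrt_mul (by positivity), pow_succ' y k,
            Nat.factorial_succ]
          push_cast
          gcongr
        have := Finset.sum_le_sum this
        have h0 : 0 ≤ y ^ 0 / √((0 : ℕ) ! : ℝ) := by positivity
        linarith
      have hS0 : 0 ≤ S (n + 2) := Finset.sum_nonneg (fun _ _ => by positivity)
      calc _ ≤ y / √((n : ℝ) + 2) * q1 + q0 := step
        _ ≤ y / √((n : ℝ) + 2) * (2 ^ (n + 1) * S (n + 1)) + 2 ^ n * S n := by gcongr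
        _ = 2 ^ (n + 1) * (y / √((n : ℝ) + 2) * S (n + 1)) + 2 ^ n * S n := by ring
        _ ≤ 2 ^ (n + 1) * S (n + 2) + 2 ^ n * S (n + 2) := by gcongr
        _ ≤ 2 ^ (n + 2) * S (n + 2) := by
          have : (0 : ℝ) ≤ 2 ^ n * S (n + 2) := by positivity
          have h4 : (2 : ℝ) ^ (n + 2) = 4 * 2 ^ n := by ring
          have h5 : (2 : ℝ) ^ (n + 1) = 2 * 2 ^ n := by ring
          rw [h4, h5]
          linarith

lemma abs_hermiteFun_mul_exp_le (n : ℕ) (x : ℝ) :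
    |hermiteFun n x| * Real.exp (x ^ 2 / 2)
      ≤ 2 ^ n * ∑ k ∈ Finset.range (n + 1), (√2 * |x|) ^ k / √(k ! : ℝ) := by
  have hpi : Real.pi ^ (-(1 / 4) : ℝ) ≤ 1 :=
    Real.rpow_le_one_of_one_le_of_nonpos (by linarith [Real.pi_gt_three]) (by norm_num)
  have h := congrArg abs (hermiteFun_mul_exp n x)
  rw [abs_mul, abs_of_pos (Real.exp_pos _), abs_mul, abs_div,
    abs_of_pos (Real.rpow_pos_of_pos Real.pi_pos _), abs_of_nonneg (Real.sqrt_nonneg _)] at h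
  rw [h]
  exact (mul_le_of_le_one_left (by positivity) hpi).trans (abs_hermitePhys_div_le n x)

/-- This is v^k/k! ≤ e^v at v = u^{1/b}, raised to the power b. -/
lemma pow_mul_rpow_factorial_neg_le {u b : ℝ} (hu : 0 ≤ u) (hb : 0 < b) (k : ℕ) :
    u ^ k * (k ! : ℝ) ^ (-b) ≤ Real.exp (b * u ^ (1 / b)) := by
  have h := Real.rpow_le_rpow (by positivity)
    (Real.pow_div_factorial_le_exp (u ^ (1 / b)) (by positivity) k) hb.le
  rw [← Real.exp_mul, Real.div_rpow (by positivity) (by positivity), ← Real.rpow_natCast,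
    ← Real.rpow_mul hu, ← Real.rpow_mul hu] at h
  have e : 1 / b * k * b = k := by field_simp
  rw [e, Real.rpow_natCast, mul_comm _ b, div_eq_mul_inv, ← Real.rpow_neg (by positivity)] at h
  exact h

lemma exists_pow_mul_rpow_factorial_neg_le {R a : ℝ} (hR : 0 ≤ R) (ha : 0 ≤ a)
    (hRa : a = 0 → R ≤ 1) : ∃ K : ℝ, 0 < K ∧ ∀ m : ℕ, R ^ m * (m ! : ℝ) ^ (-a) ≤ K := by
  rcases ha.eq_or_lt with rfl | ha
  · exact ⟨1, one_pos, fun m => by simpa using pow_le_one₀ hR (hRa rfl)⟩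
  · exact ⟨_, Real.exp_pos _, pow_mul_rpow_factorial_neg_le hR ha⟩

lemma exists_pow_mul_abs_hermiteFun_le {R a : ℝ} (hR : 0 < R) (ha : 0 ≤ a)
    (hRa : a = 0 → R ≤ 1 / 8) :
    ∃ K : ℝ, 0 < K ∧ ∀ (n : ℕ) (x : ℝ),
      R ^ n * (n ! : ℝ) ^ (-a) * (|hermiteFun n x| * Real.exp (x ^ 2 / 2))
        ≤ K * (1 / 2) ^ n * Real.exp ((a + 1 / 2) * (12 * R * |x|) ^ (1 / (a + 1 / 2))) := by
  -- 8 = 2 · 4: the 2 comes from 2^n in the Hermite bound, the 4 is traded for a factor (1/4)^n that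
  -- absorbs the n + 1 terms of the sum.
  obtain ⟨K, hK, hKm⟩ := exists_pow_mul_rpow_factorial_neg_le (R := 8 * R) (a := a)
    (by positivity) ha (fun h => by linarith [hRa h])
  refine ⟨K, hK, fun n x => ?_⟩
  have hsqrt : √2 ≤ 3 / 2 := Real.sqrt_le_iff.mpr ⟨by norm_num, by norm_num⟩
  set E := Real.exp ((a + 1 / 2) * (12 * R * |x|) ^ (1 / (a + 1 / 2)))
  have term : ∀ k ∈ Finset.range (n + 1),
      R ^ n * (n ! : ℝ) ^ (-a) * 2 ^ n * ((√2 * |x|) ^ k / √(k ! : ℝ)) ≤ (1 / 4) ^ n * (K * E) := by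
    intro k hk
    obtain ⟨m, rfl⟩ := Nat.exists_eq_add_of_le (Nat.lt_succ_iff.mp (Finset.mem_range.mp hk))
    have hf : ((k + m)! : ℝ) ^ (-a) ≤ (k ! : ℝ) ^ (-a) * (m ! : ℝ) ^ (-a) := by
      rw [← Real.mul_rpow (by positivity) (by positivity)]
      apply Real.rpow_le_rpow_of_nonpos (by positivity) _ (by linarith)
      exact_mod_cast Nat.le_of_dvd (Nat.factorial_pos _)
        (Nat.factorial_mul_factorial_dvd_factorial_add k m)
    have hk2 : (k ! : ℝ) ^ (-a) * (√(k ! : ℝ))⁻¹ = (k ! : ℝ) ^ (-(a + 1 / 2)) := by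
      rw [Real.sqrt_eq_rpow, ← Real.rpow_neg (by positivity), ← Real.rpow_add (by positivity)]
      congr 1
      ring
    have hE : (8 * R * (√2 * |x|)) ^ k * (k ! : ℝ) ^ (-(a + 1 / 2)) ≤ E := by
      refine le_trans ?_ (pow_mul_rpow_factorial_neg_le (u := 12 * R * |x|) (by positivity)
        (by positivity : 0 < a + 1 / 2) k)
      gcongr ?_ ^ k * _
      calc 8 * R * (√2 * |x|) ≤ 8 * R * (3 / 2 * |x|) := by gcongr
        _ = 12 * R * |x| := by ring
    have h4 : (1 / 4 : ℝ) ^ (k + m) * 4 ^ (k + m) = 1 := by rw [← mul_pow]; norm_num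
    calc R ^ (k + m) * ((k + m)! : ℝ) ^ (-a) * 2 ^ (k + m) * ((√2 * |x|) ^ k / √(k ! : ℝ))
        ≤ R ^ (k + m) * ((k ! : ℝ) ^ (-a) * (m ! : ℝ) ^ (-a)) * 2 ^ (k + m)
          * ((√2 * |x|) ^ k / √(k ! : ℝ)) := by gcongr
      _ = (1 / 4) ^ (k + m) * 4 ^ (k + m) * (R ^ (k + m) * ((k ! : ℝ) ^ (-a) * (m ! : ℝ) ^ (-a))
          * 2 ^ (k + m) * ((√2 * |x|) ^ k / √(k ! : ℝ))) := by rw [h4, one_mul]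
      _ = (1 / 4) ^ (k + m) * (((8 * R) ^ m * (m ! : ℝ) ^ (-a))
          * ((8 * R * (√2 * |x|)) ^ k * (k ! : ℝ) ^ (-(a + 1 / 2)))) := by
        rw [← hk2, div_eq_mul_inv, (by norm_num : (8 : ℝ) = 4 * 2)]
        simp only [mul_pow, pow_add]
        ring
      _ ≤ (1 / 4) ^ (k + m) * (K * E) := by gcongr; exact hKm m
  have hn : ((n : ℝ) + 1) * (1 / 4) ^ n ≤ (1 / 2) ^ n := by
    have h1 : ((n : ℝ) + 1) ≤ 2 ^ n := by exact_mod_cast Nat.lt_two_pow_self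
    have h2 : (1 / 2 : ℝ) ^ n = 2 ^ n * (1 / 4) ^ n := by rw [← mul_pow]; norm_num
    rw [h2]
    gcongr
  calc R ^ n * (n ! : ℝ) ^ (-a) * (|hermiteFun n x| * Real.exp (x ^ 2 / 2))
      ≤ R ^ n * (n ! : ℝ) ^ (-a)
        * (2 ^ n * ∑ k ∈ Finset.range (n + 1), (√2 * |x|) ^ k / √(k ! : ℝ)) := by
        exact mul_le_mul_of_nonneg_left (abs_hermiteFun_mul_exp_le n x) (by positivity)
    _ = ∑ k ∈ Finset.range (n + 1),
          R ^ n * (n ! : ℝ) ^ (-a) * 2 ^ n * ((√2 * |x|) ^ k / √(k ! : ℝ)) := by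
        rw [Finset.mul_sum, Finset.mul_sum]
        exact Finset.sum_congr rfl fun k _ => by ring
    _ ≤ ((n : ℝ) + 1) * (1 / 4) ^ n * (K * E) := by
        refine (Finset.sum_le_sum term).trans_eq ?_
        simp [mul_assoc]
    _ ≤ (1 / 2) ^ n * (K * E) := by gcongr
    _ = K * (1 / 2) ^ n * E := by ring

/-- With a = 0 and R = 1/16 the exponential is e^{9x²/32}, which e^{x²/2} dominates. -/
lemma exists_abs_hermiteFun_le :
    ∃ K : ℝ, 0 < K ∧ ∀ (n : ℕ) (x : ℝ), |hermiteFun n x| ≤ K * 8 ^ n := by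
  obtain ⟨K, hK, h⟩ := exists_pow_mul_abs_hermiteFun_le (R := 1 / 16) (a := 0) (by norm_num) le_rfl
    (fun _ => by norm_num)
  refine ⟨K, hK, fun n x => ?_⟩
  have h1 := h n x
  have hE : Real.exp ((0 + 1 / 2) * (12 * (1 / 16) * |x|) ^ (1 / ((0 : ℝ) + 1 / 2)))
      ≤ Real.exp (x ^ 2 / 2) := by
    rw [(by norm_num : (1 : ℝ) / (0 + 1 / 2) = (2 : ℕ)), Real.rpow_natCast, mul_pow, sq_abs]
    gcongr
    nlinarith [sq_nonneg x]
  have h16 : (16 : ℝ) ^ n * (1 / 16) ^ n = 1 := by rw [← mul_pow]; norm_num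
  have h8 : (16 : ℝ) ^ n * (1 / 2) ^ n = 8 ^ n := by rw [← mul_pow]; norm_num
  simp only [neg_zero, Real.rpow_zero, mul_one] at h1
  have h2 : |hermiteFun n x| * Real.exp (x ^ 2 / 2) ≤ K * 8 ^ n * Real.exp (x ^ 2 / 2) :=
    calc |hermiteFun n x| * Real.exp (x ^ 2 / 2)
        = 16 ^ n * ((1 / 16) ^ n * (|hermiteFun n x| * Real.exp (x ^ 2 / 2))) := by
          rw [← mul_assoc, h16, one_mul]
      _ ≤ 16 ^ n * (K * (1 / 2) ^ n * Real.exp (x ^ 2 / 2)) := by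
          refine mul_le_mul_of_nonneg_left (h1.trans ?_) (by positivity)
          gcongr
      _ = K * 8 ^ n * Real.exp (x ^ 2 / 2) := by rw [← h8]; ring
  exact le_of_mul_le_mul_right h2 (Real.exp_pos _)

/-- Dropping the factorials leaves a sum dominated by the binomial expansion of (y + 1)^n. -/
lemma abs_hermiteFun_mul_exp_le_pow (n : ℕ) (x : ℝ) :
    |hermiteFun n x| * Real.exp (x ^ 2 / 2) ≤ (6 * √(1 + x ^ 2)) ^ n := by
  set y := √2 * |x| with hy
  have hsum : ∑ k ∈ Finset.range (n + 1), y ^ k / √(k ! : ℝ) ≤ (y + 1) ^ n := by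
    rw [add_pow]
    refine Finset.sum_le_sum fun k hk => ?_
    have hc : (1 : ℝ) ≤ n.choose k := by
      exact_mod_cast Nat.choose_pos (Nat.lt_succ_iff.mp (Finset.mem_range.mp hk))
    have hk1 : 1 ≤ √(k ! : ℝ) := Real.one_le_sqrt.mpr (by exact_mod_cast Nat.factorial_pos k)
    calc y ^ k / √(k ! : ℝ) ≤ y ^ k := div_le_self (by positivity) hk1
      _ ≤ y ^ k * 1 ^ (n - k) * n.choose k := by
        simpa using le_mul_of_one_le_right (by positivity) hc
  have hy3 : y + 1 ≤ 3 * √(1 + x ^ 2) := by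
    have h1 : 1 ≤ √(1 + x ^ 2) := Real.one_le_sqrt.mpr (by nlinarith [sq_nonneg x])
    have h2 : |x| ≤ √(1 + x ^ 2) := Real.abs_le_sqrt (by linarith)
    have h3 : √2 ≤ 3 / 2 := Real.sqrt_le_iff.mpr ⟨by norm_num, by norm_num⟩
    have h4 : y ≤ 3 / 2 * √(1 + x ^ 2) := by rw [hy]; gcongr
    linarith
  calc |hermiteFun n x| * Real.exp (x ^ 2 / 2)
      ≤ 2 ^ n * ∑ k ∈ Finset.range (n + 1), y ^ k / √(k ! : ℝ) := abs_hermiteFun_mul_exp_le n x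
    _ ≤ 2 ^ n * (3 * √(1 + x ^ 2)) ^ n := by
      gcongr
      exact hsum.trans (by gcongr)
    _ = (6 * √(1 + x ^ 2)) ^ n := by rw [← mul_pow]; congr 1; ring

/-- Young's inequality with an arbitrarily small constant in front of the first term. -/
lemma exists_mul_le_rpow_add_rpow {q q' A : ℝ} (hq : q.HolderConjugate q') (hA : 0 < A) :
    ∃ B : ℝ, 0 < B ∧ ∀ n L : ℝ, 0 ≤ n → 0 ≤ L → n * L ≤ A * n ^ q + B * L ^ q' := by
  have hq0 := hq.pos
  have hq0' := hq.symm.pos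
  -- The scaling n ↦ l n, L ↦ L/l is chosen so that l^q/q = A.
  set l := (A * q) ^ (1 / q) with hl
  have hl0 : 0 < l := by positivity
  have hlq : l ^ q = A * q := by
    rw [hl, ← Real.rpow_mul (by positivity), one_div_mul_cancel hq0.ne', Real.rpow_one]
  refine ⟨(1 / l) ^ q' / q', by positivity, fun n L hn hL => ?_⟩
  have h := Real.young_inequality_of_nonneg (mul_nonneg hl0.le hn)
    (mul_nonneg (one_div_pos.mpr hl0).le hL) hq
  rw [Real.mul_rpow hl0.le hn, Real.mul_rpow (one_div_pos.mpr hl0).le hL, hlq] at h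
  calc n * L = l * n * (1 / l * L) := by field_simp
    _ ≤ _ := h
    _ = _ := by field_simp

/-! ### Hermite series in several variables -/

section HermiteSeries

variable {d : ℕ}

lemma prod_pow_length (R : ℝ) (α : Fin d → ℕ) : ∏ j, R ^ α j = R ^ length α :=
  Finset.prod_pow_eq_pow_sum _ _ _

lemma prod_const_mul_pow (K R : ℝ) (α : Fin d → ℕ) : ∏ j, (K * R ^ α j) = K ^ d * R ^ length α := by
  rw [Finset.prod_mul_distrib, prod_pow_length]
  simp

lemma prod_pow_mul_rpow_factorial (R a : ℝ) (α : Fin d → ℕ) :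
    ∏ j, (R ^ α j * ((α j)! : ℝ) ^ a) = R ^ length α * (multiFactorial α : ℝ) ^ a := by
  rw [Finset.prod_mul_distrib, prod_pow_length, multiFactorial, Nat.cast_prod,
    Real.finsetProd_rpow _ _ fun _ _ => by positivity]

lemma summable_half_pow_length : Summable fun α : Fin d → ℕ => (1 / 2 : ℝ) ^ length α := by
  refine summable_of_sum_le (c := 2 ^ d) (fun _ => by positivity) fun S => ?_
  obtain ⟨N, hN⟩ : ∃ N, ∀ α ∈ S, ∀ j, α j < N := by
    refine ⟨S.sup length + 1, fun α hα j => Nat.lt_succ_of_le ?_⟩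
    exact (Finset.single_le_sum (f := α) (fun _ _ => Nat.zero_le _) (Finset.mem_univ j)).trans
      (Finset.le_sup (f := length) hα)
  calc ∑ α ∈ S, (1 / 2 : ℝ) ^ length α
      ≤ ∑ α ∈ Fintype.piFinset fun _ : Fin d => Finset.range N, (1 / 2 : ℝ) ^ length α :=
        Finset.sum_le_sum_of_subset_of_nonneg
          (fun α hα => Fintype.mem_piFinset.mpr fun j => Finset.mem_range.mpr (hN α hα j))
          fun _ _ _ => by positivity
    _ = ∏ _j : Fin d, ∑ n ∈ Finset.range N, (1 / 2 : ℝ) ^ n := by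
        rw [Finset.prod_univ_sum]
        exact Finset.sum_congr rfl fun α _ => (prod_pow_length _ α).symm
    _ ≤ ∏ _j : Fin d, 2 := by
        refine Finset.prod_le_prod (fun _ _ => Finset.sum_nonneg fun _ _ => by positivity)
          fun _ _ => ?_
        exact (summable_geometric_two.sum_le_tsum _ fun _ _ => by positivity).trans_eq
          tsum_geometric_two
    _ = 2 ^ d := by simp

lemma exp_sq_norm_half (x : EuclideanSpace ℝ (Fin d)) :
    Real.exp (‖x‖ ^ 2 / 2) = ∏ j, Real.exp (x j ^ 2 / 2) := by
  rw [← Real.exp_sum, EuclideanSpace.real_norm_sq_eq, Finset.sum_div]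

lemma abs_hermiteFunMulti_mul_exp (α : Fin d → ℕ) (x : EuclideanSpace ℝ (Fin d)) :
    |hermiteFunMulti α x| * Real.exp (‖x‖ ^ 2 / 2)
      = ∏ j, |hermiteFun (α j) (x j)| * Real.exp (x j ^ 2 / 2) := by
  rw [hermiteFunMulti, Finset.abs_prod, exp_sq_norm_half, Finset.prod_mul_distrib]

lemma abs_coord_le (x : EuclideanSpace ℝ (Fin d)) (j : Fin d) : |x j| ≤ ‖x‖ :=
  PiLp.norm_apply_le x j

lemma abs_hermiteFunMulti_mul_exp_le_pow (α : Fin d → ℕ) (x : EuclideanSpace ℝ (Fin d)) :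
    |hermiteFunMulti α x| * Real.exp (‖x‖ ^ 2 / 2) ≤ (6 * √(1 + ‖x‖ ^ 2)) ^ length α := by
  rw [abs_hermiteFunMulti_mul_exp, ← prod_pow_length]
  refine Finset.prod_le_prod (fun _ _ => by positivity) fun j _ =>
    (abs_hermiteFun_mul_exp_le_pow _ _).trans ?_
  gcongr ?_ ^ _
  gcongr 6 * √(1 + ?_)
  exact sq_le_sq' (neg_le_of_abs_le (abs_coord_le x j)) (le_of_abs_le (abs_coord_le x j))

lemma norm_fracFourier_coeff (t : EuclideanSpace ℝ (Fin d)) (f : FormalHermiteSeries d)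
    (α : Fin d → ℕ) : ‖(fracFourier t f).coeff α‖ = ‖f.coeff α‖ := by
  rw [fracFourier, norm_mul, Complex.norm_exp]
  simp

/-- The pointwise sum of a Hermite series. -/
noncomputable def hermiteSum (f : FormalHermiteSeries d) (x : EuclideanSpace ℝ (Fin d)) : ℂ :=
  ∑' α, f.coeff α * (hermiteFunMulti α x : ℂ)

/-- Weierstrass M-test: 16^{-|α|} beats the growth 8^{|α|} of sup |h_α|. -/
lemma isFunction_hermiteSum {f : FormalHermiteSeries d} {M : ℝ}
    (h : ∀ α, ‖f.coeff α‖ ≤ M * (1 / 16) ^ length α) : f.IsFunction (hermiteSum f) := by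
  obtain ⟨K, hK, hKn⟩ := exists_abs_hermiteFun_le
  refine tendstoUniformly_tsum (summable_half_pow_length.mul_left (M * K ^ d)) fun α x => ?_
  have hM : 0 ≤ M * (1 / 16) ^ length α := (norm_nonneg _).trans (h α)
  have h1 : |hermiteFunMulti α x| ≤ K ^ d * 8 ^ length α := by
    rw [hermiteFunMulti, Finset.abs_prod, ← prod_const_mul_pow]
    exact Finset.prod_le_prod (fun _ _ => abs_nonneg _) fun j _ => hKn _ _
  have h2 : (1 / 2 : ℝ) ^ length α = (1 / 16) ^ length α * 8 ^ length α := by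
    rw [← mul_pow]; norm_num
  rw [norm_mul, Complex.norm_real, Real.norm_eq_abs, h2]
  calc ‖f.coeff α‖ * |hermiteFunMulti α x|
      ≤ M * (1 / 16) ^ length α * (K ^ d * 8 ^ length α) :=
        mul_le_mul (h α) h1 (abs_nonneg _) hM
    _ = _ := by ring

lemma omega_nonneg {E : Type*} [Norm E] (r : ℝ) (s : Index) (x : E) : 0 ≤ omega r s x := by
  cases s with
  | real s hs =>
    simp only [omega]
    split_ifs <;> positivity
  | flat σ hσ =>
    simp only [omega]
    positivity

lemma supWeightedNorm_lt_top {f : FormalHermiteSeries d} {r K : ℝ} {s : Index}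
    (h : ∀ α x, ‖f.coeff α‖ * (|hermiteFunMulti α x| * Real.exp (‖x‖ ^ 2 / 2)) * omega r s x
      ≤ K * (1 / 2) ^ length α) :
    supWeightedNorm r s (fun t => hermiteSum (fracFourier t f)) < ∞ := by
  have hs := (summable_half_pow_length (d := d)).mul_left K
  refine lt_of_le_of_lt (iSup_le fun t => ?_)
    (ENNReal.ofReal_lt_top (r := ∑' α : Fin d → ℕ, K * (1 / 2) ^ length α))
  rw [eLpNorm_exponent_top]
  refine eLpNormEssSup_le_of_ae_bound (.of_forall fun x => ?_)
  simp only [hermiteSum]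
  rw [← tsum_mul_right]
  refine tsum_of_norm_bounded hs.hasSum fun α => (le_of_eq ?_).trans (h α x)
  rw [norm_mul, norm_mul, Complex.norm_real, Complex.norm_real, norm_fracFourier_coeff,
    Real.norm_eq_abs, Real.norm_of_nonneg (mul_nonneg (Real.exp_pos _).le (omega_nonneg r s x))]
  ring

/-- Only the inclusion ℓ^p ⊂ ℓ^∞ is needed, which is why the value of p plays no role. -/
lemma exists_norm_mul_le_of_mem_weightedEll {p : ℝ≥0∞} {θ : (Fin d → ℕ) → ℝ} {c : Seq d}
    (h : c ∈ weightedEll d p θ) : ∃ M : ℝ, 0 < M ∧ ∀ α, ‖c α‖ * |θ α| ≤ M := by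
  obtain ⟨M, hM⟩ := memℓp_infty_iff.mp (Memℓp.of_exponent_ge h le_top)
  refine ⟨max M 1, by positivity, fun α => le_max_of_le_left ?_⟩
  have := hM (Set.mem_range_self α)
  rwa [norm_mul, Complex.norm_real, Real.norm_eq_abs] at this

end HermiteSeries

/-! ### Coefficient decay against the growth of Hermite functions -/

section CoefficientBounds

variable {d : ℕ} {c : Seq d}

lemma exists_norm_le_of_flat_bound {M R a : ℝ} (hM : 0 < M) (hR : 0 < R) (ha : 0 ≤ a)
    (hRa : a = 0 → R ≤ 1 / 16)
    (h : ∀ α, ‖c α‖ ≤ M * (R ^ length α * (multiFactorial α : ℝ) ^ (-a))) :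
    ∃ M' : ℝ, ∀ α, ‖c α‖ ≤ M' * (1 / 16) ^ length α := by
  obtain ⟨K, hK, hKm⟩ := exists_pow_mul_rpow_factorial_neg_le (R := 16 * R) (by positivity) ha
    (fun h => by linarith [hRa h])
  refine ⟨M * K ^ d, fun α => (h α).trans ?_⟩
  rw [mul_assoc, ← prod_const_mul_pow, ← prod_pow_mul_rpow_factorial]
  refine mul_le_mul_of_nonneg_left (Finset.prod_le_prod (fun _ _ => by positivity) fun j _ => ?_)
    hM.le
  have h16 : (16 : ℝ) ^ α j * (1 / 16) ^ α j = 1 := by rw [← mul_pow]; norm_num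
  calc R ^ α j * ((α j)! : ℝ) ^ (-a)
      = ((16 * R) ^ α j * ((α j)! : ℝ) ^ (-a)) * (1 / 16) ^ α j := by
        rw [mul_pow]; linear_combination (-(R ^ α j * ((α j)! : ℝ) ^ (-a))) * h16
    _ ≤ K * (1 / 16) ^ α j := by gcongr; exact hKm _

lemma exists_norm_mul_hermite_le_of_flat_bound {M R a r : ℝ} (hM : 0 < M) (hR : 0 < R)
    (ha : 0 ≤ a) (hRa : a = 0 → R ≤ 1 / 8)
    (h : ∀ α, ‖c α‖ ≤ M * (R ^ length α * (multiFactorial α : ℝ) ^ (-a)))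
    (hr : d * ((a + 1 / 2) * (12 * R) ^ (1 / (a + 1 / 2))) ≤ r) :
    ∃ K : ℝ, ∀ α (x : EuclideanSpace ℝ (Fin d)),
      ‖c α‖ * (|hermiteFunMulti α x| * Real.exp (‖x‖ ^ 2 / 2))
        * Real.exp (-r * ‖x‖ ^ (1 / (a + 1 / 2))) ≤ K * (1 / 2) ^ length α := by
  obtain ⟨K, hK, hKn⟩ := exists_pow_mul_abs_hermiteFun_le hR ha hRa
  refine ⟨M * K ^ d, fun α x => ?_⟩
  set b := a + 1 / 2
  have hb : 0 < b := by positivity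
  set D := b * (12 * R) ^ (1 / b)
  have hP : (R ^ length α * (multiFactorial α : ℝ) ^ (-a))
      * (|hermiteFunMulti α x| * Real.exp (‖x‖ ^ 2 / 2))
      ≤ K ^ d * (1 / 2) ^ length α * Real.exp (r * ‖x‖ ^ (1 / b)) := by
    rw [abs_hermiteFunMulti_mul_exp, ← prod_pow_mul_rpow_factorial, ← Finset.prod_mul_distrib]
    calc ∏ j, (R ^ α j * ((α j)! : ℝ) ^ (-a)
            * (|hermiteFun (α j) (x j)| * Real.exp (x j ^ 2 / 2)))
        ≤ ∏ j, (K * (1 / 2) ^ α j * Real.exp (D * ‖x‖ ^ (1 / b))) := by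
          refine Finset.prod_le_prod (fun _ _ => by positivity) fun j _ => (hKn _ _).trans ?_
          rw [Real.mul_rpow (by positivity) (abs_nonneg _), ← mul_assoc]
          gcongr
          exact abs_coord_le x j
      _ = K ^ d * (1 / 2) ^ length α * Real.exp (d * D * ‖x‖ ^ (1 / b)) := by
          rw [Finset.prod_mul_distrib, prod_const_mul_pow, ← Real.exp_sum]
          simp [mul_assoc]
      _ ≤ _ := by gcongr
  calc ‖c α‖ * (|hermiteFunMulti α x| * Real.exp (‖x‖ ^ 2 / 2)) * Real.exp (-r * ‖x‖ ^ (1 / b))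
      ≤ M * (R ^ length α * (multiFactorial α : ℝ) ^ (-a))
          * (|hermiteFunMulti α x| * Real.exp (‖x‖ ^ 2 / 2)) * Real.exp (-r * ‖x‖ ^ (1 / b)) := by
        gcongr ?_ * _ * _
        exact h α
    _ = M * ((R ^ length α * (multiFactorial α : ℝ) ^ (-a))
          * (|hermiteFunMulti α x| * Real.exp (‖x‖ ^ 2 / 2))) * Real.exp (-r * ‖x‖ ^ (1 / b)) := by
        ring
    _ ≤ M * (K ^ d * (1 / 2) ^ length α * Real.exp (r * ‖x‖ ^ (1 / b)))
          * Real.exp (-r * ‖x‖ ^ (1 / b)) := by gcongr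
    _ = M * K ^ d * (1 / 2) ^ length α
          * (Real.exp (r * ‖x‖ ^ (1 / b)) * Real.exp (-r * ‖x‖ ^ (1 / b))) := by ring
    _ = _ := by rw [← Real.exp_add]; simp

lemma exists_norm_le_of_exp_bound {M A q q' : ℝ} (hM : 0 < M) (hq : q.HolderConjugate q')
    (hA : 0 < A) (h : ∀ α, ‖c α‖ ≤ M * Real.exp (-(A * (length α : ℝ) ^ q))) :
    ∃ M' : ℝ, ∀ α, ‖c α‖ ≤ M' * (1 / 16) ^ length α := by
  obtain ⟨B, -, hBn⟩ := exists_mul_le_rpow_add_rpow hq hA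
  refine ⟨M * Real.exp (B * (Real.log 16) ^ q'), fun α => (h α).trans ?_⟩
  have hL := hBn (length α) (Real.log 16) (by positivity) (Real.log_nonneg (by norm_num))
  have e : (1 / 16 : ℝ) ^ length α = Real.exp (-(length α * Real.log 16)) := by
    rw [Real.exp_neg, Real.exp_nat_mul, Real.exp_log (by norm_num)]
    simp
  rw [e, mul_assoc, ← Real.exp_add]
  gcongr
  linarith

/-- Young's inequality enters as the hypothesis `hr` because its constants are chosen in opposite
orders: A determines r in the Roumieu case, r determines A in the Beurling case. The decay 2A pays
for two uses, at L = log 12 and L = log⟨x⟩. -/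
lemma exists_norm_mul_hermite_le_of_exp_bound {M A q q' r : ℝ} (hM : 0 < M)
    (h : ∀ α, ‖c α‖ ≤ M * Real.exp (-(2 * A * (length α : ℝ) ^ q)))
    (hr : ∀ n L : ℝ, 0 ≤ n → 0 ≤ L → n * L ≤ A * n ^ q + r * L ^ q') :
    ∃ K : ℝ, ∀ α (x : EuclideanSpace ℝ (Fin d)),
      ‖c α‖ * (|hermiteFunMulti α x| * Real.exp (‖x‖ ^ 2 / 2))
        * Real.exp (-r * (Real.log √(1 + ‖x‖ ^ 2)) ^ q') ≤ K * (1 / 2) ^ length α := by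
  refine ⟨M * Real.exp (r * (Real.log 12) ^ q'), fun α x => ?_⟩
  have hx : 1 ≤ √(1 + ‖x‖ ^ 2) := Real.one_le_sqrt.mpr (by nlinarith [sq_nonneg ‖x‖])
  have h1 := hr (length α) (Real.log 12) (by positivity) (Real.log_nonneg (by norm_num))
  have h2 := hr (length α) (Real.log √(1 + ‖x‖ ^ 2)) (by positivity) (Real.log_nonneg hx)
  set T := √(1 + ‖x‖ ^ 2)
  have e : (6 * T) ^ length α
      = Real.exp (length α * Real.log 12 + length α * Real.log T) * (1 / 2) ^ length α := by
    rw [Real.exp_add, Real.exp_nat_mul, Real.exp_nat_mul, Real.exp_log (by norm_num),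
      Real.exp_log (by positivity), ← mul_pow, ← mul_pow]
    congr 1
    ring
  calc ‖c α‖ * (|hermiteFunMulti α x| * Real.exp (‖x‖ ^ 2 / 2)) * Real.exp (-r * (Real.log T) ^ q')
      ≤ M * Real.exp (-(2 * A * (length α : ℝ) ^ q)) * (6 * T) ^ length α
          * Real.exp (-r * (Real.log T) ^ q') := by
        gcongr ?_ * _
        exact mul_le_mul (h α) (abs_hermiteFunMulti_mul_exp_le_pow α x) (by positivity)
          (by positivity)
    _ = M * Real.exp (-(2 * A * (length α : ℝ) ^ q)
          + (length α * Real.log 12 + length α * Real.log T) + -r * (Real.log T) ^ q')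
          * (1 / 2) ^ length α := by
        rw [e, Real.exp_add _ (-r * _), Real.exp_add (-(2 * A * _))]
        ring
    _ ≤ _ := by
        gcongr
        linarith

lemma exists_norm_mul_le_of_finite_support (hc : (Function.support c).Finite)
    (w : (Fin d → ℕ) → ℝ) : ∃ M : ℝ, ∀ α, ‖c α‖ * w α ≤ M := by
  refine ⟨∑ α ∈ hc.toFinset, ‖c α‖ * |w α|, fun α => ?_⟩
  by_cases hα : c α = 0
  · rw [hα, norm_zero, zero_mul]
    positivity
  · exact (mul_le_mul_of_nonneg_left (le_abs_self _) (norm_nonneg _)).trans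
      (Finset.single_le_sum (f := fun α => ‖c α‖ * |w α|) (fun _ _ => by positivity)
        (hc.mem_toFinset.mpr hα))

lemma exists_norm_mul_hermite_le_of_finite_support (hc : (Function.support c).Finite) :
    ∃ r : ℝ, 0 < r ∧ ∃ K : ℝ, ∀ α (x : EuclideanSpace ℝ (Fin d)),
      ‖c α‖ * (|hermiteFunMulti α x| * Real.exp (‖x‖ ^ 2 / 2))
        * Real.exp (-r * Real.log √(1 + ‖x‖ ^ 2)) ≤ K * (1 / 2) ^ length α := by
  obtain ⟨K, hK⟩ := exists_norm_mul_le_of_finite_support hc fun α => 12 ^ length α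
  have hK0 : 0 ≤ K := le_trans (by positivity) (hK 0)
  set N := hc.toFinset.sup length
  -- N is the largest degree present; the extra 1 keeps r positive when N = 0.
  refine ⟨N + 1, by positivity, K, fun α x => ?_⟩
  by_cases hα : c α = 0
  · rw [hα, norm_zero, zero_mul, zero_mul]
    positivity
  have hN : (length α : ℝ) ≤ N := by
    exact_mod_cast Finset.le_sup (f := length) (hc.mem_toFinset.mpr hα)
  have hx : 1 ≤ √(1 + ‖x‖ ^ 2) := Real.one_le_sqrt.mpr (by nlinarith [sq_nonneg ‖x‖])
  have hT := abs_hermiteFunMulti_mul_exp_le_pow α x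
  set T := √(1 + ‖x‖ ^ 2)
  have hlog := Real.log_nonneg hx
  have hexp : T ^ length α * Real.exp (-(N + 1) * Real.log T) ≤ 1 := by
    have e : T ^ length α = Real.exp (length α * Real.log T) := by
      rw [Real.exp_nat_mul, Real.exp_log (by positivity)]
    rw [e, ← Real.exp_add, Real.exp_le_one_iff]
    nlinarith
  have h12 : (6 : ℝ) ^ length α = 12 ^ length α * (1 / 2) ^ length α := by
    rw [← mul_pow]; norm_num
  calc ‖c α‖ * (|hermiteFunMulti α x| * Real.exp (‖x‖ ^ 2 / 2))
        * Real.exp (-(N + 1) * Real.log T)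
      ≤ ‖c α‖ * (6 * T) ^ length α * Real.exp (-(N + 1) * Real.log T) := by gcongr
    _ = ‖c α‖ * 12 ^ length α * (1 / 2) ^ length α
          * (T ^ length α * Real.exp (-(N + 1) * Real.log T)) := by
        rw [mul_pow, h12]; ring
    _ ≤ K * (1 / 2) ^ length α * 1 := by
        gcongr
        exact hK α
    _ = _ := mul_one _

lemma isFunction_hermiteSum_fracFourier {M : ℝ} (h : ∀ α, ‖c α‖ ≤ M * (1 / 16) ^ length α)
    (t : EuclideanSpace ℝ (Fin d)) :
    (fracFourier t (toSeries c)).IsFunction (hermiteSum (fracFourier t (toSeries c))) :=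
  isFunction_hermiteSum fun α => (norm_fracFourier_coeff t _ α).trans_le (h α)

lemma norm_le_of_mem_weightedEll_real {p : ℝ≥0∞} {r s : ℝ} {hs : 0 ≤ s}
    (h : c ∈ weightedEll d p (seqWeight r (.real s hs))) :
    ∃ M : ℝ, 0 < M ∧ ∀ α, ‖c α‖ ≤ M * Real.exp (-(r * (length α : ℝ) ^ (1 / (2 * s)))) := by
  obtain ⟨M, hM, hc⟩ := exists_norm_mul_le_of_mem_weightedEll h
  refine ⟨M, hM, fun α => ?_⟩
  have := hc α
  rw [seqWeight, abs_of_pos (Real.exp_pos _)] at this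
  rwa [Real.exp_neg, ← div_eq_mul_inv, le_div_iff₀ (Real.exp_pos _)]

lemma norm_le_of_mem_weightedEll_flat {p : ℝ≥0∞} {r σ : ℝ} {hσ : 0 < σ} (hr : 0 < r)
    (h : c ∈ weightedEll d p (seqWeight r (.flat σ hσ))) :
    ∃ M : ℝ, 0 < M ∧
      ∀ α, ‖c α‖ ≤ M * (r⁻¹ ^ length α * (multiFactorial α : ℝ) ^ (-(1 / (2 * σ)))) := by
  obtain ⟨M, hM, hc⟩ := exists_norm_mul_le_of_mem_weightedEll h
  refine ⟨M, hM, fun α => ?_⟩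
  have hf : (0 : ℝ) < multiFactorial α := by
    exact_mod_cast Finset.prod_pos fun j _ => Nat.factorial_pos (α j)
  have := hc α
  rw [seqWeight, abs_of_pos (by positivity)] at this
  rwa [Real.rpow_neg hf.le, inv_pow, ← mul_inv, ← div_eq_mul_inv, le_div_iff₀ (by positivity)]

lemma holderConjugate_of_pos_of_lt_half {s : ℝ} (hs : 0 < s) (hs2 : s < 1 / 2) :
    (1 / (2 * s)).HolderConjugate (1 / (1 - 2 * s)) := by
  rw [Real.holderConjugate_iff]
  constructor
  · rw [lt_div_iff₀ (by positivity)]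
    linarith
  · simp

lemma one_div_flat_exponent {σ : ℝ} (hσ : 0 < σ) :
    1 / (1 / (2 * σ) + 1 / 2) = 2 * σ / (σ + 1) := by
  field_simp
  ring

/-- In the Beurling case R may be taken arbitrarily small, so any prescribed r > 0 is reached. Using
d + 1 avoids a division by zero when d = 0. -/
lemma exists_small_radius (d : ℕ) {b r ε : ℝ} (hb : 0 < b) (hr : 0 < r) (hε : 0 < ε) :
    ∃ R : ℝ, 0 < R ∧ R ≤ ε ∧ d * (b * (12 * R) ^ (1 / b)) ≤ r := by
  set R₀ := (r / ((d + 1) * b)) ^ b / 12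
  have hR₀ : 0 < R₀ := by positivity
  refine ⟨min R₀ ε, lt_min hR₀ hε, min_le_right _ _, ?_⟩
  have hp : (12 * R₀) ^ (1 / b) = r / ((d + 1) * b) := by
    rw [mul_div_cancel₀ _ (by norm_num), ← Real.rpow_mul (by positivity),
      mul_one_div_cancel hb.ne', Real.rpow_one]
  have hmin : 0 < min R₀ ε := lt_min hR₀ hε
  calc d * (b * (12 * min R₀ ε) ^ (1 / b)) ≤ (d + 1) * (b * (12 * R₀) ^ (1 / b)) := by
        gcongr
        · linarith
        · exact min_le_left _ _
    _ = r := by rw [hp]; field_simp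

end CoefficientBounds

/-! ### The Roumieu and Beurling spaces, according to s -/

lemma exists_supWeightedNorm_lt_top_of_mem_spaceRoumieu {d : ℕ} {p : ℝ≥0∞} {s : Index}
    (hs : s < Index.half) {f : FormalHermiteSeries d} (hf : f ∈ spaceRoumieu d p s) :
    (∀ t, (fracFourier t f).IsFunction (hermiteSum (fracFourier t f))) ∧
      ∃ r : ℝ, 0 < r ∧ supWeightedNorm r s (fun t => hermiteSum (fracFourier t f)) < ∞ := by
  obtain ⟨c, hc, rfl⟩ := hf
  rw [ellRoumieu] at hc
  split_ifs at hc with h0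
  · subst h0
    obtain ⟨M, hM⟩ := exists_norm_mul_le_of_finite_support hc fun α => 16 ^ length α
    obtain ⟨r, hr, K, hK⟩ := exists_norm_mul_hermite_le_of_finite_support hc
    refine ⟨isFunction_hermiteSum_fracFourier (M := M) fun α => ?_, r, hr,
      supWeightedNorm_lt_top (K := K) fun α x => ?_⟩
    · rw [one_div, inv_pow, ← div_eq_mul_inv, le_div_iff₀ (by positivity)]
      exact hM α
    · simpa [omega, Index.zero, toSeries] using hK α x
  · simp only [Set.mem_iUnion] at hc
    obtain ⟨r, hr, hc⟩ := hc
    cases s with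
    | real s hs0 =>
      have hs2 : s < 1 / 2 := hs
      have hs1 : 0 < s := hs0.lt_of_ne fun h => h0 (by subst h; rfl)
      have hq := holderConjugate_of_pos_of_lt_half hs1 hs2
      obtain ⟨M, hM, hc⟩ := norm_le_of_mem_weightedEll_real hc
      obtain ⟨M', hM'⟩ := exists_norm_le_of_exp_bound hM hq hr hc
      obtain ⟨B, hB, hBn⟩ := exists_mul_le_rpow_add_rpow hq (half_pos hr)
      obtain ⟨K, hK⟩ := exists_norm_mul_hermite_le_of_exp_bound hM
        (by simpa only [mul_div_cancel₀ r (two_ne_zero' ℝ)] using hc) hBn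
      refine ⟨isFunction_hermiteSum_fracFourier hM', B, hB,
        supWeightedNorm_lt_top (K := K) fun α x => ?_⟩
      simp only [omega, if_pos hs2]
      exact hK α x
    | flat σ hσ =>
      obtain ⟨M, hM, hc⟩ := norm_le_of_mem_weightedEll_flat hr hc
      have ha : 0 < 1 / (2 * σ) := by positivity
      obtain ⟨M', hM'⟩ := exists_norm_le_of_flat_bound hM (inv_pos.mpr hr) ha.le
        (fun h => absurd h ha.ne') hc
      obtain ⟨K, hK⟩ := exists_norm_mul_hermite_le_of_flat_bound (r := d * ((1 / (2 * σ) + 1 / 2)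
        * (12 * r⁻¹) ^ (1 / (1 / (2 * σ) + 1 / 2))) + 1) hM (inv_pos.mpr hr) ha.le
        (fun h => absurd h ha.ne') hc (le_add_of_nonneg_right zero_le_one)
      refine ⟨isFunction_hermiteSum_fracFourier hM', d * ((1 / (2 * σ) + 1 / 2)
        * (12 * r⁻¹) ^ (1 / (1 / (2 * σ) + 1 / 2))) + 1, by positivity,
        supWeightedNorm_lt_top (K := K) fun α x => ?_⟩
      simp only [omega, ← one_div_flat_exponent hσ]
      exact hK α x

lemma supWeightedNorm_lt_top_of_mem_spaceBeurling {d : ℕ} {p : ℝ≥0∞} {s : Index}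
    (h0 : Index.zero < s) (hs : s ≤ Index.half) {f : FormalHermiteSeries d}
    (hf : f ∈ spaceBeurling d p s) :
    (∀ t, (fracFourier t f).IsFunction (hermiteSum (fracFourier t f))) ∧
      ∀ r : ℝ, 0 < r → supWeightedNorm r s (fun t => hermiteSum (fracFourier t f)) < ∞ := by
  obtain ⟨c, hc, rfl⟩ := hf
  rw [ellBeurling, if_neg (by rintro rfl; exact lt_irrefl (0 : ℝ) h0)] at hc
  simp only [Set.mem_iInter] at hc
  cases s with
  | real s hs0 =>
    have hs1 : 0 < s := h0
    rcases hs with hs | hs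
    · have hs2 : s < 1 / 2 := hs
      have hq := holderConjugate_of_pos_of_lt_half hs1 hs2
      obtain ⟨M, hM, hc1⟩ := norm_le_of_mem_weightedEll_real (hc 1 one_pos)
      obtain ⟨M', hM'⟩ := exists_norm_le_of_exp_bound hM hq one_pos hc1
      refine ⟨isFunction_hermiteSum_fracFourier hM', fun r hr => ?_⟩
      -- The exponents are swapped so that the prescribed r multiplies the power of L; the resulting
      -- A is affordable because every decay rate is available.
      obtain ⟨A, hA, hAn⟩ := exists_mul_le_rpow_add_rpow hq.symm hr
      obtain ⟨M, hM, hcA⟩ := norm_le_of_mem_weightedEll_real (hc (2 * A) (by positivity))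
      obtain ⟨K, hK⟩ := exists_norm_mul_hermite_le_of_exp_bound (r := r) hM hcA
        (q' := 1 / (1 - 2 * s)) (fun n L hn hL => by linarith [hAn L n hL hn])
      refine supWeightedNorm_lt_top (K := K) fun α x => ?_
      simp only [omega, if_pos hs2]
      exact hK α x
    · obtain rfl : s = 1 / 2 := by simpa [Index.half] using hs
      -- At s = 1/2 the weight is e^{ρ|α|}; taking ρ = -log R, positive for R < 1, gives the ♭-type
      -- bound with a = 0.
      have bound : ∀ R : ℝ, 0 < R → R < 1 → ∃ M : ℝ, 0 < M ∧
          ∀ α, ‖c α‖ ≤ M * (R ^ length α * (multiFactorial α : ℝ) ^ (-(0 : ℝ))) := by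
        intro R hR hR1
        obtain ⟨M, hM, hcM⟩ := norm_le_of_mem_weightedEll_real
          (hc (-Real.log R) (neg_pos.mpr (Real.log_neg hR hR1)))
        refine ⟨M, hM, fun α => (hcM α).trans_eq ?_⟩
        have e : (1 : ℝ) / (2 * (1 / 2)) = 1 := by norm_num
        rw [e, Real.rpow_one, neg_zero, Real.rpow_zero, mul_one, neg_mul, neg_neg, 
          mul_comm (Real.log R),
          Real.exp_nat_mul, Real.exp_log hR]
      obtain ⟨M, hM, hc1⟩ := bound (1 / 16) (by norm_num) (by norm_num)
      obtain ⟨M', hM'⟩ := exists_norm_le_of_flat_bound hM (by norm_num) le_rfl (fun _ => le_rfl) hc1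
      refine ⟨isFunction_hermiteSum_fracFourier hM', fun r hr => ?_⟩
      obtain ⟨R, hR, hR8, hRr⟩ := exists_small_radius d (b := 0 + 1 / 2) (by norm_num) hr
        (by norm_num : (0 : ℝ) < 1 / 8)
      obtain ⟨M, hM, hcR⟩ := bound R hR (by linarith)
      obtain ⟨K, hK⟩ := exists_norm_mul_hermite_le_of_flat_bound hM hR le_rfl (fun _ => hR8) hcR hRr
      refine supWeightedNorm_lt_top (K := K) fun α x => ?_
      have e : (1 : ℝ) / (0 + 1 / 2) = (2 : ℕ) := by norm_num
      have := hK α x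
      rw [e, Real.rpow_natCast] at this
      simpa only [omega, if_neg (lt_irrefl (1 / 2 : ℝ))] using! this
  | flat σ hσ =>
    have ha : 0 < 1 / (2 * σ) := by positivity
    obtain ⟨M, hM, hc1⟩ := norm_le_of_mem_weightedEll_flat one_pos (hc 1 one_pos)
    obtain ⟨M', hM'⟩ := exists_norm_le_of_flat_bound hM (inv_pos.mpr one_pos) ha.le
      (fun h => absurd h ha.ne') hc1
    refine ⟨isFunction_hermiteSum_fracFourier hM', fun r hr => ?_⟩
    obtain ⟨R, hR, -, hRr⟩ := exists_small_radius d (b := 1 / (2 * σ) + 1 / 2) (by positivity) hr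
      one_pos
    obtain ⟨M, hM, hcR⟩ := norm_le_of_mem_weightedEll_flat (inv_pos.mpr hR) (hc R⁻¹ (inv_pos.mpr hR))
    rw [inv_inv] at hcR
    obtain ⟨K, hK⟩ := exists_norm_mul_hermite_le_of_flat_bound hM hR ha.le
      (fun h => absurd h ha.ne') hcR hRr
    refine supWeightedNorm_lt_top (K := K) fun α x => ?_
    simp only [omega, ← one_div_flat_exponent hσ]
    exact hK α x

end Pilipovic

theorem proposition2p5 (d : ℕ) (p : ℝ≥0∞) (hp : 1 ≤ p) (s : Pilipovic.Index) :
    (s < Pilipovic.Index.half →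
      ∀ f ∈ Pilipovic.spaceRoumieu d p s,
        ∃ g : EuclideanSpace ℝ (Fin d) → EuclideanSpace ℝ (Fin d) → ℂ,
          (∀ t, (Pilipovic.fracFourier t f).IsFunction (g t)) ∧
          ∃ r : ℝ, 0 < r ∧ Pilipovic.supWeightedNorm r s g < ∞) ∧
    (Pilipovic.Index.zero < s → s ≤ Pilipovic.Index.half →
      ∀ f ∈ Pilipovic.spaceBeurling d p s,
        ∃ g : EuclideanSpace ℝ (Fin d) → EuclideanSpace ℝ (Fin d) → ℂ,
          (∀ t, (Pilipovic.fracFourier t f).IsFunction (g t)) ∧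
          ∀ r : ℝ, 0 < r → Pilipovic.supWeightedNorm r s g < ∞) := by
  exact ⟨fun hs f hf => ⟨_, Pilipovic.exists_supWeightedNorm_lt_top_of_mem_spaceRoumieu hs hf⟩,
    fun h0 hs f hf => ⟨_, Pilipovic.supWeightedNorm_lt_top_of_mem_spaceBeurling h0 hs hf⟩⟩
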